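/- Let $q$ be a prime power, let $k$ be a positive integer and let $s \ge 0$ be an integer with $\gcd(s,k)=1$. Let $\gamma \in \mathbb{F}_{q^{2k}} \setminus \mathbb{F}_{q^k}$, and consider the $\mathbb{F}_q$-subspace $$V_{x^{q^s},\gamma} = \{\, u + u^{q^s}\gamma : u \in \mathbb{F}_{q^k} \,\}$$ of $\mathbb{F}_{q^{2k}}$. An $\mathbb{F}_q$-subspace $V$ of $\mathbb{F}_{q^{2k}}$ is called a Sidon space if, for all nonzero $a,b,c,d \in V$, $ab = cd$ implies $\{a\mathbb{F}_q, b\mathbb{F}_q\} = \{c\mathbb{F}_q, d\mathbb{F}_q\}$. Let $\mathrm{N}_{q^{2k}/q}(\gamma) = \gamma^{\frac{q^{2k}-1}{q-1}}$ denote the norm of $\gamma$ over $\mathbb{F}_q$. If $\mathrm{N}_{q^{2k}/q}(\gamma) \neq 1$, then $V_{x^{q^s},\gamma}$ is a Sidon space. Moreover, if $k \ge 3$, then $V_{x^{q^s},\gamma}$ is a Sidon space if and only if $\mathrm{N}_{q^{2k}/q}(\gamma) \neq 1$. -/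

import Mathlib

open scoped Polynomial

/-- An `F`-subspace `V` of a field extension `L` of `F` is a Sidon space if, for all nonzero
`a, b, c, d` in `V`, `ab = cd` implies `{aF, bF} = {cF, dF}`, where `eF` is the `F`-span of `e`. -/
def IsSidonSpace {F L : Type*} [Field F] [Field L] [Algebra F L] (V : Submodule F L) : Prop :=
  ∀ a ∈ V, ∀ b ∈ V, ∀ c ∈ V, ∀ d ∈ V, a ≠ 0 → b ≠ 0 → c ≠ 0 → d ≠ 0 → a * b = c * d →
    ({Submodule.span F {a}, Submodule.span F {b}} : Set (Submodule F L)) =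
      {Submodule.span F {c}, Submodule.span F {d}}

/-- With `q` the cardinality of the finite field `F`, a polynomial over `K` is linearized
(a `q`-polynomial) if it has the shape `∑ i, f_i x ^ (q ^ i)`, i.e. if only monomials whose
exponent is a power of `q` occur in it. -/
def IsLinearized (F : Type*) {K : Type*} [Field K] (f : K[X]) : Prop :=
  ∀ m ∈ f.support, ∃ i : ℕ, m = Nat.card F ^ i

theorem isLinearized_X_pow (F K : Type*) [Field K] (s : ℕ) :
    IsLinearized F (Polynomial.X ^ (Nat.card F ^ s) : K[X]) := by
  intro m hm
  rw [Polynomial.mem_support_iff, Polynomial.coeff_X_pow] at hm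
  exact ⟨s, by by_contra h; simp [h] at hm⟩

section

variable {F K : Type*} [Field F] [Finite F] [Field K] [Algebra F K]

theorem add_pow_natCard_pow (i : ℕ) (u v : K) :
    (u + v) ^ (Nat.card F ^ i) = u ^ (Nat.card F ^ i) + v ^ (Nat.card F ^ i) := by
  have := Fintype.ofFinite F
  induction i with
  | zero => simp
  | succ i ih =>
    have h (w : K) : FiniteField.frobeniusAlgHom F K w = w ^ Nat.card F := by
      rw [Nat.card_eq_fintype_card, FiniteField.coe_frobeniusAlgHom]
    rw [pow_succ, pow_mul, pow_mul, pow_mul, ih, ← h, ← h, ← h, map_add]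

theorem smul_pow_natCard_pow (i : ℕ) (r : F) (u : K) :
    (r • u) ^ (Nat.card F ^ i) = r • u ^ (Nat.card F ^ i) := by
  have := Fintype.ofFinite F
  rw [smul_pow, Nat.card_eq_fintype_card, FiniteField.pow_card_pow]

/-- The `F`-linear endomorphism of `K` defined by evaluating a linearized polynomial. -/
noncomputable def linearizedEval (f : K[X]) (hf : IsLinearized F f) : K →ₗ[F] K where
  toFun u := f.eval u
  map_add' u v := by
    simp only [Polynomial.eval_eq_sum, Polynomial.sum, ← Finset.sum_add_distrib]
    refine Finset.sum_congr rfl fun m hm => ?_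
    obtain ⟨i, rfl⟩ := hf m hm
    rw [add_pow_natCard_pow, mul_add]
  map_smul' r u := by
    simp only [Polynomial.eval_eq_sum, Polynomial.sum, Finset.smul_sum, RingHom.id_apply]
    refine Finset.sum_congr rfl fun m hm => ?_
    obtain ⟨i, rfl⟩ := hf m hm
    rw [smul_pow_natCard_pow, mul_smul_comm]

end

/-- The `F`-subspace `V_{f,γ} = {u + f(u) γ : u ∈ K}` of `L`, for a linearized polynomial `f`
over the intermediate field `K` of `L / F` and `γ ∈ L`. -/
noncomputable def polySubspace {F L : Type*} [Field F] [Finite F] [Field L] [Algebra F L]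
    {K : IntermediateField F L} (f : K[X]) (hf : IsLinearized F f) (γ : L) : Submodule F L where
  carrier := {x | ∃ u : K, x = (u : L) + ((f.eval u : K) : L) * γ}
  zero_mem' := ⟨0, by
    have h : f.eval 0 = 0 := (linearizedEval f hf).map_zero
    simp [h]⟩
  add_mem' := by
    rintro _ _ ⟨u, rfl⟩ ⟨v, rfl⟩
    have h : f.eval (u + v) = f.eval u + f.eval v := (linearizedEval f hf).map_add u v
    exact ⟨u + v, by rw [h]; push_cast; ring⟩
  smul_mem' := by
    rintro r _ ⟨u, rfl⟩
    have h : f.eval (r • u) = r • f.eval u := (linearizedEval f hf).map_smul r u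
    exact ⟨r • u, by rw [h]; simp [smul_add]⟩

/-! Write `γ² = Tγ - N` with `N` the norm of `γ` to `K`, and let `σ` be `u ↦ u ^ (q ^ s)`, a
generator of `Gal(K/F)`. Comparing coordinates in the basis `1, γ`, two products of elements `u +
σ(u)γ` agree iff `w = ab - cd` satisfies `N σ(w) = w` together with a second, polar equation
(`mul_eq_mul_iff_of_mul_self_eq`).

If `N` has norm different from `1`, then `w = 0`, and the pairs `{aσ(b), bσ(a)}` and `{cσ(d),
dσ(c)}` have equal sum and product, hence coincide; the resulting ratios are fixed by `σ`, so lie in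
`F`. If the norm is `1`, Hilbert 90 gives a solution `w ≠ 0`, and
`exists_mul_sub_mul_eq_and_polar_eq` realizes it: additive Hilbert 90 reduces this to an isotropic
vector of a form over `F` in `k ≥ 3` variables, found by Chevalley–Warning. -/

/-- A bilinear form in at least three variables over a finite field has a nonzero isotropic
vector. -/
theorem exists_ne_zero_apply_self_eq_zero {F V : Type*} [Field F] [Finite F] [AddCommGroup V]
    [Module F V] (B : V →ₗ[F] V →ₗ[F] F) (hV : 3 ≤ Module.finrank F V) :
    ∃ v : V, v ≠ 0 ∧ B v v = 0 := by
  classical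
  have := Fintype.ofFinite F
  have : FiniteDimensional F V := Module.finite_of_finrank_pos (by omega)
  let e := Module.finBasis F V
  let f : MvPolynomial (Fin (Module.finrank F V)) F :=
    ∑ i, ∑ j, MvPolynomial.C (B (e i) (e j)) * (MvPolynomial.X i * MvPolynomial.X j)
  have hf (x : Fin (Module.finrank F V) → F) :
      MvPolynomial.eval x f = B (∑ i, x i • e i) (∑ i, x i • e i) := by
    simp only [f, map_sum, map_mul, MvPolynomial.eval_C, MvPolynomial.eval_X, LinearMap.map_smul,
      LinearMap.sum_apply, LinearMap.smul_apply, smul_eq_mul]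
    rw [Finset.sum_comm]
    exact Finset.sum_congr rfl fun i _ => Finset.sum_congr rfl fun j _ => by ring
  have hdeg : f.totalDegree ≤ 2 := by
    refine MvPolynomial.totalDegree_finsetSum_le fun i _ =>
      MvPolynomial.totalDegree_finsetSum_le fun j _ => ?_
    refine (MvPolynomial.totalDegree_mul _ _).trans ?_
    rw [MvPolynomial.totalDegree_C, zero_add]
    refine (MvPolynomial.totalDegree_mul _ _).trans ?_
    simp [MvPolynomial.totalDegree_X]
  obtain ⟨p, hp⟩ := CharP.exists F
  have hprime : p.Prime := (CharP.char_is_prime_or_zero F p).resolve_right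
    (CharP.char_ne_zero_of_finite F p)
  -- Chevalley–Warning: the degree is below the number of variables, so `p` divides the number of
  -- zeros, and `0` is not the only one.
  have hdvd := char_dvd_card_solutions p (f := f) (by rw [Fintype.card_fin]; omega)
  have h0 : MvPolynomial.eval 0 f = 0 := by rw [hf]; simp
  have hcard : 1 < Fintype.card {x // MvPolynomial.eval x f = 0} :=
    hprime.one_lt.trans_le
      (Nat.le_of_dvd (Fintype.card_pos_iff.mpr ⟨⟨0, h0⟩⟩) hdvd)
  obtain ⟨⟨x, hx⟩, hne⟩ := Fintype.exists_ne_of_one_lt_card hcard ⟨0, h0⟩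
  refine ⟨∑ i, x i • e i, fun h => hne ?_, by rw [← hf, hx]⟩
  have := Fintype.linearIndependent_iff.mp e.linearIndependent x h
  exact Subtype.ext (funext this)

/-! ### Cyclic Galois theory and Hilbert 90 -/

section

variable {F K : Type*} [Field F] [Finite F] [Field K] [Algebra F K] [FiniteDimensional F K]

/-- If `gcd(s, [K : F]) = 1`, then the map `u ↦ u ^ (q ^ s)` generates the Galois group of `K`
over the field `F` with `q` elements. -/
theorem exists_generator_apply_eq_pow (s : ℕ) (hs : Nat.gcd s (Module.finrank F K) = 1) :
    ∃ σ : Gal(K/F), (∀ u, σ u = u ^ Nat.card F ^ s) ∧ ∀ τ, τ ∈ Subgroup.zpowers σ := by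
  have := Fintype.ofFinite F
  have : Finite K := Module.finite_of_finite F
  let φ := FiniteField.frobeniusAlgEquivOfAlgebraic F K
  have hφ : orderOf φ = Module.finrank F K := FiniteField.orderOf_frobeniusAlgEquivOfAlgebraic F K
  refine ⟨φ ^ s, fun u => ?_, fun τ => ?_⟩
  · rw [AlgEquiv.coe_pow, FiniteField.coe_frobeniusAlgEquivOfAlgebraic_iterate,
      Nat.card_eq_fintype_card]
  · have h : Subgroup.zpowers (φ ^ s) = ⊤ := by
      refine Subgroup.eq_top_of_card_eq _ ?_
      rw [Nat.card_zpowers, Nat.Coprime.orderOf_pow, hφ, IsGalois.card_aut_eq_finrank]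
      rw [hφ, Nat.coprime_comm]
      exact hs
    exact h ▸ Subgroup.mem_top τ

theorem mem_range_algebraMap_of_generator_fixes {σ : Gal(K/F)}
    (hσ : ∀ τ, τ ∈ Subgroup.zpowers σ) {r : K} (hr : σ r = r) :
    ∃ x : F, algebraMap F K x = r := by
  have : Finite K := Module.finite_of_finite F
  refine IntermediateField.mem_bot.mp ((IsGalois.mem_bot_iff_fixed r).mpr fun τ => ?_)
  have h : σ ∈ MulAction.stabilizer Gal(K/F) r := hr
  exact (Subgroup.zpowers_le.mpr h) (hσ τ)

end

section

variable {F K : Type*} [Field F] [Finite F] [Field K] [Algebra F K] [FiniteDimensional F K]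

/-- Multiplicative **Hilbert 90** for finite fields. -/
theorem exists_mul_apply_eq_of_norm_eq_one {σ : Gal(K/F)}
    (hσ : ∀ τ, τ ∈ Subgroup.zpowers σ) {η : K} (hη : Algebra.norm F η = 1) :
    ∃ w : K, w ≠ 0 ∧ η * σ w = w := by
  have : Finite K := Module.finite_of_finite F
  let ν : Kˣ →* Fˣ := Units.map (Algebra.norm F (S := K))
  let ψ : Kˣ →* Kˣ := MonoidHom.id Kˣ / Units.map (σ : K →* K)
  have hker : ψ.ker ≤ (Units.map (algebraMap F K : F →* K)).range := by
    intro y hy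
    have hy' : (y : K) = σ y := congrArg Units.val (div_eq_one.mp hy)
    obtain ⟨x, hx⟩ := mem_range_algebraMap_of_generator_fixes hσ hy'.symm
    have hx0 : x ≠ 0 := by
      rintro rfl
      exact y.ne_zero (by rw [← hx, map_zero])
    exact ⟨Units.mk0 x hx0, Units.ext hx⟩
  have hrange : ψ.range ≤ ν.ker := by
    rintro _ ⟨y, rfl⟩
    have h : ν (Units.map (σ : K →* K) y) = ν y :=
      Units.ext (Algebra.norm_eq_of_algEquiv σ (y : K))
    change ν (y / Units.map (σ : K →* K) y) = 1
    rw [map_div, h, div_self']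
  have hψ : Nat.card ψ.ker * Nat.card ψ.range = Nat.card Kˣ := by
    rw [← Subgroup.index_ker, Subgroup.card_mul_index]
  have hν : Nat.card ν.ker * Nat.card Fˣ = Nat.card Kˣ := by
    rw [← Subgroup.card_mul_index ν.ker, Subgroup.index_ker,
      MonoidHom.range_eq_top.mpr (FiniteField.unitsMap_norm_surjective F K), Subgroup.card_top]
  have hle : Nat.card ψ.ker ≤ Nat.card Fˣ :=
    (Subgroup.card_le_of_le hker).trans
      (Nat.card_le_card_of_surjective _ (MonoidHom.rangeRestrict_surjective _))
  -- The kernel of `ψ` embeds in `Fˣ` and `ν` is surjective, so counting makes the inclusion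
  -- `hrange` an equality.
  have hcard : Nat.card ν.ker ≤ Nat.card ψ.range := by
    refine Nat.le_of_mul_le_mul_right (c := Nat.card Fˣ) ?_ Nat.card_pos
    rw [hν, ← hψ, mul_comm]
    exact Nat.mul_le_mul_left _ hle
  have heq := Subgroup.eq_of_le_of_card_ge hrange hcard
  have hη0 : η ≠ 0 := by
    rintro rfl
    simp [Algebra.norm_zero] at hη
  have hmem : Units.mk0 η hη0 ∈ ψ.range := by
    rw [heq]
    exact Units.ext hη
  obtain ⟨y, hy⟩ := hmem
  refine ⟨y, y.ne_zero, ?_⟩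
  have h : y = Units.mk0 η hη0 * Units.map (σ : K →* K) y := div_eq_iff_eq_mul.mp hy
  exact (congrArg Units.val h).symm

/-- Additive **Hilbert 90** for finite fields. -/
theorem exists_apply_sub_eq_of_trace_eq_zero {σ : Gal(K/F)}
    (hσ : ∀ τ, τ ∈ Subgroup.zpowers σ) {z : K} (hz : Algebra.trace F K z = 0) :
    ∃ e : K, σ e - e = z := by
  have : Finite K := Module.finite_of_finite F
  let δ : K →ₗ[F] K := σ.toLinearMap - LinearMap.id
  have hker : LinearMap.ker δ ≤ LinearMap.range (Algebra.linearMap F K) := by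
    intro y hy
    exact mem_range_algebraMap_of_generator_fixes hσ (sub_eq_zero.mp hy)
  have hrange : LinearMap.range δ ≤ LinearMap.ker (Algebra.trace F K) := by
    rintro _ ⟨y, rfl⟩
    change Algebra.trace F K (σ y - y) = 0
    rw [map_sub, Algebra.trace_eq_of_algEquiv, sub_self]
  have h1 : Module.finrank F (LinearMap.ker δ) ≤ 1 :=
    (Submodule.finrank_mono hker).trans
      ((LinearMap.finrank_range_le _).trans_eq (Module.finrank_self F))
  have h2 := LinearMap.finrank_range_add_finrank_ker δ
  have h3 := LinearMap.finrank_range_add_finrank_ker (Algebra.trace F K)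
  rw [LinearMap.range_eq_top.mpr (Algebra.trace_surjective F K), finrank_top,
    Module.finrank_self] at h3
  have heq := Submodule.eq_of_le_of_finrank_le hrange (by omega)
  have hmem : z ∈ LinearMap.range δ := by
    rw [heq]
    exact hz
  exact hmem

/-- If `[K : F] ≥ 3`, then there are `a, b, c, d` with prescribed values of `ab - cd` and
of `a σ(b) + b σ(a) - c σ(d) - d σ(c)`. -/
theorem exists_mul_sub_mul_eq_and_polar_eq {σ : Gal(K/F)}
    (hσ : ∀ τ, τ ∈ Subgroup.zpowers σ) (hK : 3 ≤ Module.finrank F K) (w t : K) :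
    ∃ a b c d : K, a * b - c * d = w ∧ a * σ b + b * σ a - c * σ d - d * σ c = t := by
  obtain ⟨r, hr⟩ : ∃ r : K, σ r ≠ r := by
    by_contra! h
    have hsurj : Function.Surjective (Algebra.linearMap F K) := fun r =>
      mem_range_algebraMap_of_generator_fixes hσ (h r)
    have := LinearMap.finrank_range_le (Algebra.linearMap F K)
    rw [LinearMap.range_eq_top.mpr hsurj, finrank_top, Module.finrank_self] at this
    omega
  have hρ : σ r - r ≠ 0 := sub_ne_zero.mpr hr
  -- On the diagonal, `B x x = 0` is exactly the trace condition for solving `he'` for `e`.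
  let B : K →ₗ[F] K →ₗ[F] F := LinearMap.mk₂ F
    (fun u v => Algebra.trace F K ((σ r - r)⁻¹ * (t * (u * σ v) - σ (w * (u * v)) - w * (u * v))))
    (fun u u' v => by rw [← map_add]; congr 1; simp only [map_mul, map_add]; ring)
    (fun x u v => by
      rw [← map_smul]; congr 1; simp only [Algebra.smul_def, map_mul, AlgEquiv.commutes]; ring)
    (fun u v v' => by rw [← map_add]; congr 1; simp only [map_mul, map_add]; ring)
    (fun x u v => by
      rw [← map_smul]; congr 1; simp only [Algebra.smul_def, map_mul, AlgEquiv.commutes]; ring)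
  obtain ⟨x, hx, hBx⟩ := exists_ne_zero_apply_self_eq_zero B hK
  obtain ⟨e, he⟩ := exists_apply_sub_eq_of_trace_eq_zero hσ hBx
  have hσx : σ x ≠ 0 := (map_ne_zero σ).mpr hx
  have he' : (σ r - r) * (σ e - e) = t * (x * σ x) - σ w * (σ x * σ x) - w * (x * x) := by
    rw [he, mul_inv_cancel_left₀ hρ, map_mul, map_mul]
  -- For every `e` this gives `ab - cd = w`, while `e` enters the polar expression only through `(σ
  -- r - r)(σ e - e) / (x σ x)`; clearing denominators leaves `he'`.
  refine ⟨x⁻¹, w * x + r * x⁻¹ * e, r * x⁻¹, x⁻¹ * e, ?_, ?_⟩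
  · field_simp
    ring
  · simp only [map_add, map_mul, map_inv₀]
    field_simp
    linear_combination he'

end

/-! ### Products in the quadratic extension -/

/-- An element of a quadratic extension satisfies its characteristic equation, whose constant
coefficient is its norm. -/
theorem exists_mul_self_eq_of_finrank_eq_two {K L : Type*} [Field K] [Field L] [Algebra K L]
    (h : Module.finrank K L = 2) (γ : L) :
    ∃ T : K, γ * γ = algebraMap K L T * γ - algebraMap K L (Algebra.norm K γ) := by
  have : FiniteDimensional K L := Module.finite_of_finrank_pos (by omega)
  let P := (Algebra.lmul K L γ).charpoly
  have hdeg : P.natDegree = 2 := by rw [LinearMap.charpoly_natDegree, h]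
  have hlead : P.coeff 2 = 1 := by
    rw [← hdeg]
    exact LinearMap.charpoly_monic _
  have hnorm : Algebra.norm K γ = P.coeff 0 := by
    rw [Algebra.norm_apply, LinearMap.det_eq_sign_charpoly_coeff, h]
    simp [P]
  have hP : Polynomial.aeval γ P = 0 := Algebra.aeval_self_charpoly_lmul γ
  rw [Polynomial.aeval_eq_sum_range, hdeg, Finset.sum_range_succ, Finset.sum_range_succ,
    Finset.sum_range_one, hlead, ← hnorm] at hP
  simp only [Algebra.smul_def, map_one, pow_zero, pow_one] at hP
  refine ⟨-P.coeff 1, ?_⟩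
  rw [map_neg]
  linear_combination hP

theorem eq_and_eq_of_add_mul_eq_add_mul {F L : Type*} [Field F] [Field L] [Algebra F L]
    {K : IntermediateField F L} {γ : L} (hγ : γ ∉ K) {x y x' y' : K}
    (h : (x : L) + y * γ = x' + y' * γ) : x = x' ∧ y = y' := by
  have hy : y = y' := by
    by_contra hne
    have hne' : (y : L) - y' ≠ 0 := sub_ne_zero.mpr fun h => hne (Subtype.ext h)
    refine hγ ?_
    have : γ = ((x' - x) / (y - y') : K) := by
      push_cast
      rw [eq_div_iff hne']
      linear_combination h
    rw [this]
    exact SetLike.coe_mem _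
  subst hy
  exact ⟨Subtype.ext (add_right_cancel h), rfl⟩

/-- Comparison of two products of elements `u + σ(u) γ`, when `γ² = T γ - N`. -/
theorem mul_eq_mul_iff_of_mul_self_eq {F L : Type*} [Field F] [Field L] [Algebra F L]
    {K : IntermediateField F L} {γ : L} (hγ : γ ∉ K) {N T : K} (h : γ * γ = T * γ - N)
    (σ : Gal(K/F)) (a b c d : K) :
    ((a : L) + σ a * γ) * (b + σ b * γ) = (c + σ c * γ) * (d + σ d * γ) ↔
      N * σ (a * b - c * d) = a * b - c * d ∧
        a * σ b + b * σ a - c * σ d - d * σ c = -(T * σ (a * b - c * d)) := by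
  have expand (u v : K) : ((u : L) + σ u * γ) * (v + σ v * γ) =
      ((u * v - N * (σ u * σ v) : K) : L) + ((u * σ v + v * σ u + T * (σ u * σ v) : K) : L) * γ := by
    push_cast
    linear_combination (σ u : L) * σ v * h
  rw [expand, expand]
  simp only [map_sub, map_mul]
  constructor
  · intro heq
    obtain ⟨h1, h2⟩ := eq_and_eq_of_add_mul_eq_add_mul hγ heq
    exact ⟨by linear_combination -h1, by linear_combination h2⟩
  · rintro ⟨h1, h2⟩
    rw [show a * b - N * (σ a * σ b) = c * d - N * (σ c * σ d) by linear_combination -h1,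
      show a * σ b + b * σ a + T * (σ a * σ b) = c * σ d + d * σ c + T * (σ c * σ d) by
        linear_combination h2]

theorem span_singleton_eq_of_eq_smul {F L : Type*} [Field F] [Field L] [Algebra F L] {x y : L}
    {r : F} (hx : x ≠ 0) (h : x = r • y) : Submodule.span F {x} = Submodule.span F {y} := by
  have hr : r ≠ 0 := by
    rintro rfl
    exact hx (by rw [h, zero_smul])
  rw [h, Submodule.span_singleton_smul_eq (IsUnit.mk0 r hr)]

section

variable {F K : Type*} [Field F] [Finite F] [Field K] [Algebra F K] [FiniteDimensional F K]

/-- If `a b = c d` and `a σ(b) = c σ(d)`, then `a` and `c`, as well as `d` and `b`, differ by the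
same factor in `F`. -/
theorem exists_algebraMap_mul_eq {σ : Gal(K/F)} (hσ : ∀ τ, τ ∈ Subgroup.zpowers σ)
    {a b c d : K} (hb : b ≠ 0) (hc : c ≠ 0) (h : a * b = c * d)
    (h' : a * σ b = c * σ d) : ∃ r : F, a = r • c ∧ d = r • b := by
  have hσb : σ b ≠ 0 := (map_ne_zero σ).mpr hb
  have hac : a / c = d / b := by
    rw [div_eq_div_iff hc hb]
    linear_combination h
  have hfix : σ (a / c) = a / c := by
    rw [hac, map_div₀, ← hac, div_eq_div_iff hσb hc]
    linear_combination -h'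
  obtain ⟨r, hr⟩ := mem_range_algebraMap_of_generator_fixes hσ hfix
  refine ⟨r, ?_, ?_⟩
  · rw [Algebra.smul_def, hr, div_mul_cancel₀ a hc]
  · rw [Algebra.smul_def, hr, hac, div_mul_cancel₀ d hb]

end

/-! ### The Sidon property -/

section

variable {F L : Type*} [Field F] [Finite F] [Field L] [Algebra F L]
  {K : IntermediateField F L}

theorem mem_polySubspace_X_pow_iff {s : ℕ} {γ x : L} {σ : Gal(K/F)}
    (hσ : ∀ u, σ u = u ^ Nat.card F ^ s) :
    x ∈ polySubspace (Polynomial.X ^ (Nat.card F ^ s) : K[X]) (isLinearized_X_pow F K s) γ ↔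
      ∃ u : K, x = (u : L) + σ u * γ := by
  change (∃ u : K, x = (u : L) +
    ((Polynomial.eval u (Polynomial.X ^ (Nat.card F ^ s) : K[X]) : K) : L) * γ) ↔ _
  simp only [Polynomial.eval_pow, Polynomial.eval_X, hσ]

variable [FiniteDimensional F K]

theorem isSidonSpace_polySubspace_X_pow {s : ℕ} {γ : L} {σ : Gal(K/F)}
    (hσ : ∀ u, σ u = u ^ Nat.card F ^ s) (hgen : ∀ τ, τ ∈ Subgroup.zpowers σ) (hγ : γ ∉ K)
    {N T : K} (h : γ * γ = T * γ - N) (hN : Algebra.norm F N ≠ 1) :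
    IsSidonSpace
      (polySubspace (Polynomial.X ^ (Nat.card F ^ s) : K[X]) (isLinearized_X_pow F K s) γ) := by
  intro x hx y hy z hz t ht hx0 hy0 hz0 ht0 hxy
  rw [mem_polySubspace_X_pow_iff hσ] at hx hy hz ht
  obtain ⟨a, rfl⟩ := hx
  obtain ⟨b, rfl⟩ := hy
  obtain ⟨c, rfl⟩ := hz
  obtain ⟨d, rfl⟩ := ht
  have ne_zero {u : K} (hu : (u : L) + σ u * γ ≠ 0) : u ≠ 0 := by
    rintro rfl
    simp at hu
  have hb := ne_zero hy0
  have hc := ne_zero hz0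
  have hd := ne_zero ht0
  have span_eq {u v : K} {r : F} (hu : (u : L) + σ u * γ ≠ 0) (huv : u = r • v) :
      Submodule.span F {(u : L) + σ u * γ} = Submodule.span F {(v : L) + σ v * γ} := by
    refine span_singleton_eq_of_eq_smul (r := r) hu ?_
    rw [huv, map_smul]
    simp [smul_add]
  obtain ⟨h1, h2⟩ := (mul_eq_mul_iff_of_mul_self_eq hγ h σ a b c d).mp hxy
  -- Norms are `σ`-invariant, so a nonzero solution of `N σ(w) = w` would force `N` to have norm
  -- `1`.
  have hw : a * b - c * d = 0 := by
    by_contra hw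
    have hnorm := congrArg (Algebra.norm F) h1
    rw [map_mul, Algebra.norm_eq_of_algEquiv] at hnorm
    exact hN (mul_eq_right₀ (Algebra.norm_ne_zero_iff.mpr hw) |>.mp hnorm)
  rw [hw, map_zero, mul_zero, neg_zero] at h2
  have hab : a * b = c * d := sub_eq_zero.mp hw
  have hσab : σ a * σ b = σ c * σ d := by rw [← map_mul, hab, map_mul]
  -- `aσ(b)` is a root of the quadratic with roots `cσ(d)` and `dσ(c)`.
  have hprod : (a * σ b - c * σ d) * (a * σ b - d * σ c) = 0 := by
    linear_combination a * σ b * h2 - σ a * σ b * hab - c * d * hσab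
  rcases mul_eq_zero.mp hprod with h3 | h3
  · obtain ⟨r, hr, hr'⟩ := exists_algebraMap_mul_eq hgen hb hc hab (sub_eq_zero.mp h3)
    rw [span_eq hx0 hr, span_eq ht0 hr']
  · obtain ⟨r, hr, hr'⟩ := exists_algebraMap_mul_eq hgen hb hd (hab.trans (mul_comm c d))
      (sub_eq_zero.mp h3)
    rw [span_eq hx0 hr, span_eq hz0 hr', Set.pair_comm]

theorem not_isSidonSpace_polySubspace_X_pow {s : ℕ} {γ : L} {σ : Gal(K/F)}
    (hσ : ∀ u, σ u = u ^ Nat.card F ^ s) (hgen : ∀ τ, τ ∈ Subgroup.zpowers σ) (hγ : γ ∉ K)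
    {N T : K} (h : γ * γ = T * γ - N) (hN : Algebra.norm F N = 1)
    (hK : 3 ≤ Module.finrank F K) :
    ¬ IsSidonSpace
      (polySubspace (Polynomial.X ^ (Nat.card F ^ s) : K[X]) (isLinearized_X_pow F K s) γ) := by
  intro hS
  obtain ⟨w, hw, hNw⟩ := exists_mul_apply_eq_of_norm_eq_one hgen hN
  obtain ⟨a, b, c, d, h1, h2⟩ := exists_mul_sub_mul_eq_and_polar_eq hgen hK w (-(T * σ w))
  have hprod := (mul_eq_mul_iff_of_mul_self_eq hγ h σ a b c d).mpr
    ⟨by rw [h1, hNw], by rw [h2, h1]⟩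
  have inj {u v : K} {r : F} (huv : r • ((v : L) + σ v * γ) = (u : L) + σ u * γ) : r • v = u := by
    refine (eq_and_eq_of_add_mul_eq_add_mul hγ (y := r • σ v) (y' := σ u) ?_).1
    rw [← huv]
    simp [smul_add]
  have eq_zero {u : K} (hu : (u : L) + σ u * γ = 0) : u = 0 :=
    (eq_and_eq_of_add_mul_eq_add_mul hγ (x' := 0) (y' := 0) (by simpa using hu)).1
  have mem (u : K) : (u : L) + σ u * γ ∈
      polySubspace (Polynomial.X ^ (Nat.card F ^ s) : K[X]) (isLinearized_X_pow F K s) γ :=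
    (mem_polySubspace_X_pow_iff hσ).mpr ⟨u, rfl⟩
  -- A zero factor would make both products vanish, hence `xy = zt = 0`.
  have coe_ne_zero {x y z t : K} (hxy : ((x : L) + σ x * γ) * (y + σ y * γ) =
      (z + σ z * γ) * (t + σ t * γ)) (hne : x * y - z * t ≠ 0) :
      (x : L) + σ x * γ ≠ 0 ∧ (y : L) + σ y * γ ≠ 0 := by
    rw [← mul_ne_zero_iff]
    intro h0
    refine hne ?_
    have hzt := hxy.symm.trans h0
    have hxy0 : x * y = 0 := by
      rcases mul_eq_zero.mp h0 with h | h <;> simp [eq_zero h]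
    have hzt0 : z * t = 0 := by
      rcases mul_eq_zero.mp hzt with h | h <;> simp [eq_zero h]
    rw [hxy0, hzt0, sub_zero]
  have hne : a * b - c * d ≠ 0 := h1 ▸ hw
  obtain ⟨ha0, hb0⟩ := coe_ne_zero hprod hne
  obtain ⟨hc0, hd0⟩ := coe_ne_zero hprod.symm (by rwa [← neg_sub, neg_ne_zero])
  have hsets := hS _ (mem a) _ (mem b) _ (mem c) _ (mem d) ha0 hb0 hc0 hd0 hprod
  -- If `x = rz` with `r` in `F`, cancellation gives `t = ry`, hence `xy = zt`.
  have false_of {x y z t : K} (hxy : ((x : L) + σ x * γ) * (y + σ y * γ) =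
      (z + σ z * γ) * (t + σ t * γ)) (hne : x * y - z * t ≠ 0) (hz : (z : L) + σ z * γ ≠ 0)
      (hspan : Submodule.span F {(x : L) + σ x * γ} = Submodule.span F {(z : L) + σ z * γ}) :
      False := by
    have hmem : (x : L) + σ x * γ ∈ Submodule.span F {(z : L) + σ z * γ} :=
      hspan ▸ Submodule.mem_span_singleton_self _
    obtain ⟨r, hr⟩ := Submodule.mem_span_singleton.mp hmem
    have ht : r • ((y : L) + σ y * γ) = t + σ t * γ := by
      refine mul_left_cancel₀ hz ?_
      rw [← hxy, ← hr, mul_smul_comm, smul_mul_assoc]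
    refine hne ?_
    rw [← inj hr, ← inj ht, mul_smul_comm, smul_mul_assoc, sub_self]
  have hmem : Submodule.span F {(a : L) + σ a * γ} ∈
      ({Submodule.span F {(c : L) + σ c * γ}, Submodule.span F {(d : L) + σ d * γ}} :
        Set (Submodule F L)) := hsets ▸ Set.mem_insert _ _
  rcases hmem with hac | had
  · exact false_of hprod hne hc0 hac
  · exact false_of (hprod.trans (mul_comm _ _)) (by rwa [mul_comm d c]) hd0 had

end

theorem mainTheorem4 {F L : Type*} [Field F] [Finite F] [Field L] [Algebra F L]
    (k s : ℕ) (hk : 0 < k) (hs : Nat.gcd s k = 1)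
    (hL : Module.finrank F L = 2 * k)
    (K : IntermediateField F L) (hK : Module.finrank F K = k)
    (γ : L) (hγ : γ ∉ K) :
    (Algebra.norm F γ ≠ 1 →
      IsSidonSpace (polySubspace (Polynomial.X ^ (Nat.card F ^ s) : K[X]) (isLinearized_X_pow F K s) γ)) ∧
    (3 ≤ k →
      (IsSidonSpace (polySubspace (Polynomial.X ^ (Nat.card F ^ s) : K[X]) (isLinearized_X_pow F K s) γ) ↔
        Algebra.norm F γ ≠ 1)) := by
  have : FiniteDimensional F L := Module.finite_of_finrank_pos (by omega)
  subst hK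
  have hKL : Module.finrank K L = 2 := by
    refine Nat.eq_of_mul_eq_mul_left hk ?_
    rw [Module.finrank_mul_finrank, hL, mul_comm]
  obtain ⟨σ, hσ, hgen⟩ := exists_generator_apply_eq_pow (F := F) (K := K) s hs
  obtain ⟨T, hT⟩ := exists_mul_self_eq_of_finrank_eq_two hKL γ
  have hnorm : Algebra.norm F (Algebra.norm K γ) = Algebra.norm F γ := Algebra.norm_norm
  rw [← hnorm]
  have sidon := isSidonSpace_polySubspace_X_pow hσ hgen hγ hT
  exact ⟨sidon, fun hk3 => ⟨fun hS hN =>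
    not_isSidonSpace_polySubspace_X_pow hσ hgen hγ hT hN hk3 hS, sidon⟩⟩
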